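/- Let $Q(z)=\frac{\sqrt z}{\tanh\sqrt z}\in\mathbb{Q}[[z]]$. For $k\ge 1$, the Hirzebruch $L$-polynomial $\mathsf L_k=\mathsf L_k(\mathsf p_1,\ldots,\mathsf p_k)\in\mathbb{Q}[\mathsf p_1,\ldots,\mathsf p_k]$ is the unique polynomial which, when each $\mathsf p_j$ is replaced by the $j$-th elementary symmetric polynomial in variables $z_1,\ldots,z_k$, becomes the homogeneous part of degree $k$ of $Q(z_1)\cdots Q(z_k)$. For a partition $(j_1,\ldots,j_r)$ of $k$ (that is, integers $j_1\ge\cdots\ge j_r\ge 1$ with $j_1+\cdots+j_r=k$), let $h_{j_1,\ldots,j_r}\in\mathbb{Q}$ denote the coefficient of the monomial $\mathsf p_{j_1}\cdots\mathsf p_{j_r}$ in $\mathsf L_k$. Then, for every $k\ge 1$ and every partition $(j_1,\ldots,j_r)$ of $k$, the coefficient $h_{j_1,\ldots,j_r}$ is non-zero; it is negative if $r$ is even and positive if $r$ is odd. -/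

import Mathlib

noncomputable section

namespace HirzebruchL

/-- The power series `sinh √z / √z = ∑ zⁿ / (2n+1)!`. -/
def sinhSeries : PowerSeries ℚ :=
  PowerSeries.mk fun n => 1 / ((2 * n + 1).factorial : ℚ)

/-- The power series `cosh √z = ∑ zⁿ / (2n)!`. -/
def coshSeries : PowerSeries ℚ :=
  PowerSeries.mk fun n => 1 / ((2 * n).factorial : ℚ)

/-- The characteristic power series `Q(z) = √z / tanh √z = cosh √z / (sinh √z / √z)`.
The constant coefficient of the denominator is `1`, so this is a genuine quotient. -/
def charSeries : PowerSeries ℚ :=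
  coshSeries * sinhSeries⁻¹

/-- The part of degree `k` of `Q(z₁) ⋯ Q(z_k)`. Only the coefficients of `Q` up to degree `k`
enter into it, so `Q` may be replaced by its truncation, which is a polynomial. -/
def symmetricPart (k : ℕ) : MvPolynomial (Fin k) ℚ :=
  MvPolynomial.homogeneousComponent k
    (∏ i : Fin k, Polynomial.aeval (MvPolynomial.X i : MvPolynomial (Fin k) ℚ)
      (PowerSeries.trunc (k + 1) charSeries))

theorem symmetricPart_isSymmetric (k : ℕ) : (symmetricPart k).IsSymmetric := by
  intro e
  unfold symmetricPart
  rw [MvPolynomial.rename_homogeneousComponent, map_prod]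
  congr 1
  simp only [← Polynomial.aeval_algHom_apply, MvPolynomial.rename_X]
  exact Equiv.prod_comp e fun i =>
    Polynomial.aeval (MvPolynomial.X i : MvPolynomial (Fin k) ℚ)
      (PowerSeries.trunc (k + 1) charSeries)

/-- The Hirzebruch polynomial `L_k(p₁, …, p_k)`, in which the variable `X i` stands for `p_{i+1}`:
the unique polynomial that becomes the part of degree `k` of `Q(z₁) ⋯ Q(z_k)` when each `p_j` is
replaced by the `j`-th elementary symmetric polynomial in `z₁, …, z_k`. -/
def LPolynomial (k : ℕ) : MvPolynomial (Fin k) ℚ :=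
  (MvPolynomial.esymmAlgEquiv (Fin k) ℚ (Fintype.card_fin k)).symm
    ⟨symmetricPart k, symmetricPart_isSymmetric k⟩

/-- The exponent vector of the monomial `p_{j₁} ⋯ p_{j_r}` of a partition `(j₁, …, j_r)` of `k`:
the exponent of `p_ℓ` is the number of parts equal to `ℓ`. -/
def partitionExponent {k : ℕ} (J : k.Partition) : Fin k →₀ ℕ :=
  Finsupp.equivFunOnFinite.symm fun i => J.parts.count ((i : ℕ) + 1)

/-- The coefficient `h_{j₁, …, j_r}` of `p_{j₁} ⋯ p_{j_r}` in `L_k`. -/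
def h {k : ℕ} (J : k.Partition) : ℚ :=
  MvPolynomial.coeff (partitionExponent J) (LPolynomial k)

end HirzebruchL

end

/-! Euler's products suggest `Q(z) = ∏ (1 + bᵢ z) / (1 + aᵢ z)` with `bᵢ = 4 / (π² (2i+1)²)` and `aᵢ
= 4 / (π² (2i+2)²)`, so that `b₀ > a₀ > b₁ > a₁ > … > 0`. Since `∏ⱼ (1 + x zⱼ s) = 1 + ∑ⱼ xʲ pⱼ sʲ`,
the substitution `pⱼ ↦ -pⱼ` turns the generating series of the `L_k` into `R = ∏ (1 - e(bᵢ)) / (1 -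
e(aᵢ))`, where `e(x) = ∑ⱼ xʲ pⱼ sʲ`, and multiplies `h_J` by `(-1)^r`. It remains to see that `1 -
R` has positive coefficients.

For `x ≥ y ≥ 0`, `(1 - e(y)) / (1 - e(x)) = 1 + (e(x) - e(y)) / (1 - e(x))` has nonnegative
coefficients. If `R'` is `R` without its first factor, then `1 - R = (1 - R') + (e(b₀) - e(a₀)) · R'
/ (1 - e(a₀))`. Grouping each `aᵢ` with `bᵢ₊₁` makes the last quotient nonnegative, and `1 - R'` is
handled by induction. All this is done for finite products;
`exists_pos_le_coeff_one_sub_ratioSeries` gives a bound independent of their length, so strictness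
survives the limit.

Coefficientwise convergence to `Q` (`tendsto_coeff_ratio`) is obtained by comparing logarithmic
derivatives: their coefficients are alternating zeta sums on one side and values of Bernoulli
polynomials at `1/2` on the other. -/

noncomputable section

/-! ### Positivity of power series over polynomial rings. -/

namespace HirzebruchL

/-- All coefficients of a power series over a polynomial ring are nonnegative. -/
def CoeffNonneg {σ : Type*} (f : PowerSeries (MvPolynomial σ ℝ)) : Prop :=
  ∀ n d, 0 ≤ (PowerSeries.coeff n f).coeff d

namespace CoeffNonneg

variable {σ : Type*} {f g : PowerSeries (MvPolynomial σ ℝ)}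

theorem zero : CoeffNonneg (0 : PowerSeries (MvPolynomial σ ℝ)) := fun n d => by simp

theorem one : CoeffNonneg (1 : PowerSeries (MvPolynomial σ ℝ)) := fun n d => by
  classical
  rw [PowerSeries.coeff_one]
  split_ifs
  · rw [MvPolynomial.coeff_one]
    split_ifs <;> norm_num
  · simp

theorem add (hf : CoeffNonneg f) (hg : CoeffNonneg g) : CoeffNonneg (f + g) := fun n d => by
  rw [map_add, MvPolynomial.coeff_add]
  exact add_nonneg (hf n d) (hg n d)

theorem mul (hf : CoeffNonneg f) (hg : CoeffNonneg g) : CoeffNonneg (f * g) := fun n d => by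
  classical
  rw [PowerSeries.coeff_mul, MvPolynomial.coeff_sum]
  refine Finset.sum_nonneg fun p _ => ?_
  rw [MvPolynomial.coeff_mul]
  exact Finset.sum_nonneg fun q _ => mul_nonneg (hf _ _) (hg _ _)

/-- A fixed point of `g = 1 + f * g` has nonnegative coefficients if `f` does. -/
theorem of_eq_one_add_mul (hf : CoeffNonneg f) (hf0 : PowerSeries.coeff 0 f = 0)
    (h : g = 1 + f * g) : CoeffNonneg g := by
  classical
  intro n
  induction n using Nat.strong_induction_on with
  | _ n ih =>
    intro d
    rw [h, map_add, MvPolynomial.coeff_add]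
    refine add_nonneg (one n d) ?_
    rw [PowerSeries.coeff_mul, MvPolynomial.coeff_sum]
    refine Finset.sum_nonneg fun p hp => ?_
    rw [Finset.HasAntidiagonal.mem_antidiagonal] at hp
    rcases Nat.eq_zero_or_pos p.1 with h0 | h0
    · rw [h0, hf0, zero_mul, MvPolynomial.coeff_zero]
    · rw [MvPolynomial.coeff_mul]
      exact Finset.sum_nonneg fun q _ => mul_nonneg (hf _ _) (ih _ (by omega) _)

end CoeffNonneg

variable {k : ℕ}

/-- The series `∑ⱼ cⱼ pⱼ sʲ`, where `p_{j+1}` is the variable `X j`. -/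
def linSeries (c : Fin k → ℝ) : PowerSeries (MvPolynomial (Fin k) ℝ) :=
  ∑ j : Fin k, PowerSeries.monomial ((j : ℕ) + 1) (MvPolynomial.monomial (Finsupp.single j 1) (c j))

theorem linSeries_sub (b c : Fin k → ℝ) : linSeries (b - c) = linSeries b - linSeries c := by
  simp [linSeries, map_sub, Finset.sum_sub_distrib]

theorem coeff_zero_linSeries (c : Fin k → ℝ) : PowerSeries.coeff 0 (linSeries c) = 0 := by
  simp [linSeries, PowerSeries.coeff_monomial]

theorem coeffNonneg_linSeries {c : Fin k → ℝ} (hc : 0 ≤ c) : CoeffNonneg (linSeries c) := by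
  classical
  intro n d
  rw [linSeries, map_sum, MvPolynomial.coeff_sum]
  refine Finset.sum_nonneg fun j _ => ?_
  rw [PowerSeries.coeff_monomial]
  split_ifs
  · rw [MvPolynomial.coeff_monomial]
    split_ifs
    exacts [hc j, le_rfl]
  · simp

theorem coeff_linSeries (c : Fin k → ℝ) (j : Fin k) :
    (PowerSeries.coeff ((j : ℕ) + 1) (linSeries c)).coeff (Finsupp.single j 1) = c j := by
  classical
  rw [linSeries, map_sum, MvPolynomial.coeff_sum, Finset.sum_eq_single j]
  · simp
  · intro i _ hij
    rw [PowerSeries.coeff_monomial, if_neg (by simpa [Fin.ext_iff] using Ne.symm hij),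
      MvPolynomial.coeff_zero]
  · simp

/-- The left side is a single term of the two nested Cauchy products, and all other terms are
nonnegative. -/
theorem mul_coeff_le_coeff_linSeries_mul {c : Fin k → ℝ} (hc : 0 ≤ c)
    {g : PowerSeries (MvPolynomial (Fin k) ℝ)} (hg : CoeffNonneg g) (j : Fin k) (n : ℕ)
    (d : Fin k →₀ ℕ) :
    c j * (PowerSeries.coeff n g).coeff d ≤
      (PowerSeries.coeff ((j : ℕ) + 1 + n) (linSeries c * g)).coeff (Finsupp.single j 1 + d) := by
  classical
  have hl := coeffNonneg_linSeries hc
  rw [PowerSeries.coeff_mul, MvPolynomial.coeff_sum]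
  refine le_trans ?_ (Finset.single_le_sum (fun p _ => ?_)
    (Finset.HasAntidiagonal.mem_antidiagonal.2 (rfl : ((j : ℕ) + 1, n).1 + ((j : ℕ) + 1, n).2 = _)))
  · rw [MvPolynomial.coeff_mul]
    refine le_trans ?_ (Finset.single_le_sum
      (fun q _ => mul_nonneg (hl _ _) (hg _ _))
      (Finset.HasAntidiagonal.mem_antidiagonal.2
        (rfl : (Finsupp.single j 1, d).1 + (Finsupp.single j 1, d).2 = _)))
    rw [coeff_linSeries]
  · rw [MvPolynomial.coeff_mul]
    exact Finset.sum_nonneg fun q _ => mul_nonneg (hl _ _) (hg _ _)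

/-- The weight of a monomial, where `X j` has weight `j + 1`. -/
def weight (d : Fin k →₀ ℕ) : ℕ := d.sum fun j m => m * ((j : ℕ) + 1)

theorem weight_single_add (j : Fin k) (d : Fin k →₀ ℕ) :
    weight (Finsupp.single j 1 + d) = (j : ℕ) + 1 + weight d := by
  classical
  rw [weight, Finsupp.sum_add_index' (by simp) (by intros; ring)]
  simp [weight]

theorem exists_eq_single_add {d : Fin k →₀ ℕ} (hd : d ≠ 0) :
    ∃ j d', d = Finsupp.single j 1 + d' := by
  obtain ⟨j, hj⟩ := Finsupp.ne_iff.1 hd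
  refine ⟨j, d - Finsupp.single j 1, (add_tsub_cancel_of_le ?_).symm⟩
  rw [Finsupp.single_le_iff]
  exact Nat.one_le_iff_ne_zero.2 hj

/-- All coefficients of the correct weight are positive. -/
def CoeffPos (f : PowerSeries (MvPolynomial (Fin k) ℝ)) : Prop :=
  ∀ d, 0 < (PowerSeries.coeff (weight d) f).coeff d

theorem coeff_linSeries_mul_pos {c : Fin k → ℝ} (hc : ∀ j, 0 < c j)
    {g : PowerSeries (MvPolynomial (Fin k) ℝ)} (hg : CoeffNonneg g) (hg' : CoeffPos g)
    {d : Fin k →₀ ℕ} (hd : d ≠ 0) :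
    0 < (PowerSeries.coeff (weight d) (linSeries c * g)).coeff d := by
  obtain ⟨j, d, rfl⟩ := exists_eq_single_add hd
  rw [weight_single_add]
  exact (mul_pos (hc j) (hg' d)).trans_le
    (mul_coeff_le_coeff_linSeries_mul (fun j => (hc j).le) hg j _ d)

theorem coeffPos_one_add_linSeries_mul {c : Fin k → ℝ} (hc : ∀ j, 0 < c j)
    {g : PowerSeries (MvPolynomial (Fin k) ℝ)} (hg : CoeffNonneg g) (hg' : CoeffPos g) :
    CoeffPos (1 + linSeries c * g) := by
  intro d
  rw [map_add, MvPolynomial.coeff_add]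
  by_cases hd : d = 0
  · subst hd
    have h := (coeffNonneg_linSeries fun j => (hc j).le).mul hg (weight (0 : Fin k →₀ ℕ)) 0
    have h1 : ((PowerSeries.coeff (weight (0 : Fin k →₀ ℕ)))
      (1 : PowerSeries (MvPolynomial (Fin k) ℝ))).coeff 0 = 1 := by
      simp [weight]
    rw [h1]
    linarith
  · exact add_pos_of_nonneg_of_pos (CoeffNonneg.one _ _)
      (coeff_linSeries_mul_pos hc hg hg' hd)

/-- The inverse of `1 - ∑ⱼ cⱼ pⱼ sʲ`. -/
def geomSeries (c : Fin k → ℝ) : PowerSeries (MvPolynomial (Fin k) ℝ) :=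
  PowerSeries.invOfUnit (1 - linSeries c) 1

theorem one_sub_linSeries_mul_geomSeries (c : Fin k → ℝ) :
    (1 - linSeries c) * geomSeries c = 1 := by
  refine PowerSeries.mul_invOfUnit _ _ ?_
  rw [map_sub, ← PowerSeries.coeff_zero_eq_constantCoeff_apply (linSeries c), coeff_zero_linSeries]
  simp

theorem geomSeries_eq (c : Fin k → ℝ) : geomSeries c = 1 + linSeries c * geomSeries c := by
  linear_combination one_sub_linSeries_mul_geomSeries c

theorem coeffNonneg_geomSeries {c : Fin k → ℝ} (hc : 0 ≤ c) : CoeffNonneg (geomSeries c) :=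
  (coeffNonneg_linSeries hc).of_eq_one_add_mul (coeff_zero_linSeries c) (geomSeries_eq c)

theorem coeffPos_geomSeries {c : Fin k → ℝ} (hc : ∀ j, 0 < c j) : CoeffPos (geomSeries c) := by
  have hn := coeffNonneg_geomSeries (fun j => (hc j).le)
  suffices ∀ n d, weight d = n → 0 < (PowerSeries.coeff n (geomSeries c)).coeff d from
    fun d => this _ d rfl
  intro n
  induction n using Nat.strong_induction_on with
  | _ n ih =>
    intro d hd
    by_cases h0 : d = 0
    · subst h0
      obtain rfl : n = 0 := by rw [← hd]; simp [weight]
      rw [geomSeries_eq, PowerSeries.coeff_zero_eq_constantCoeff_apply, map_add, map_mul,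
        ← PowerSeries.coeff_zero_eq_constantCoeff_apply (linSeries c), coeff_zero_linSeries]
      simp
    · obtain ⟨j, d, rfl⟩ := exists_eq_single_add h0
      rw [weight_single_add] at hd
      subst hd
      rw [geomSeries_eq, map_add, MvPolynomial.coeff_add]
      exact add_pos_of_nonneg_of_pos (CoeffNonneg.one _ _)
        ((mul_pos (hc j) (ih _ (by omega) d rfl)).trans_le
          (mul_coeff_le_coeff_linSeries_mul (fun j => (hc j).le) hn j _ d))

/-! ### Interlacing and the sign of the coefficients of finite products. -/

/-- `∏_{i < M} (1 - e(bᵢ)) / (1 - e(aᵢ))`, with `e(c) = ∑ⱼ cⱼ pⱼ sʲ`. -/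
def ratioSeries (a b : ℕ → Fin k → ℝ) (M : ℕ) : PowerSeries (MvPolynomial (Fin k) ℝ) :=
  ∏ i ∈ Finset.range M, ((1 - linSeries (b i)) * geomSeries (a i))

theorem ratioSeries_succ (a b : ℕ → Fin k → ℝ) (M : ℕ) :
    ratioSeries a b (M + 1) = (1 - linSeries (b 0)) * geomSeries (a 0) *
      ratioSeries (fun i => a (i + 1)) (fun i => b (i + 1)) M := by
  rw [ratioSeries, Finset.prod_range_succ', mul_comm]
  rfl

theorem geomSeries_mul_one_sub_linSeries (c b : Fin k → ℝ) :
    geomSeries c * (1 - linSeries b) = 1 + linSeries (c - b) * geomSeries c := by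
  rw [linSeries_sub]
  linear_combination one_sub_linSeries_mul_geomSeries c

/-- The factors are regrouped with a shift: `c` is paired with `b 0`, then each `a i` with `b (i +
1)`. Every pair is `1` plus a nonnegative series, and the final unpaired `geomSeries` is too. -/
theorem coeffNonneg_geomSeries_mul_ratioSeries (M : ℕ) (a b : ℕ → Fin k → ℝ) (c : Fin k → ℝ)
    (hcb : b 0 ≤ c) (ha : ∀ i, 0 ≤ a i) (hab : ∀ i, a i ≤ b i) (hba : ∀ i, b (i + 1) ≤ a i) :
    CoeffNonneg (geomSeries c * ratioSeries a b M - 1) := by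
  induction M generalizing a b c with
  | zero =>
    have hc : 0 ≤ c := (ha 0).trans ((hab 0).trans hcb)
    have : geomSeries c * ratioSeries a b 0 - 1 = linSeries c * geomSeries c := by
      rw [ratioSeries, Finset.prod_range_zero]
      linear_combination geomSeries_eq c
    rw [this]
    exact (coeffNonneg_linSeries hc).mul (coeffNonneg_geomSeries hc)
  | succ M ih =>
    have hc : 0 ≤ c := (ha 0).trans ((hab 0).trans hcb)
    have hG := ih (fun i => a (i + 1)) (fun i => b (i + 1)) (a 0) (hba 0) (fun i => ha _)
      (fun i => hab _) (fun i => hba _)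
    set G := geomSeries (a 0) * ratioSeries (fun i => a (i + 1)) (fun i => b (i + 1)) M
    have hu := (coeffNonneg_linSeries (sub_nonneg.2 hcb)).mul (coeffNonneg_geomSeries hc)
    have : geomSeries c * ratioSeries a b (M + 1) - 1 =
        (G - 1) + linSeries (c - b 0) * geomSeries c * ((G - 1) + 1) := by
      rw [ratioSeries_succ]
      linear_combination G * geomSeries_mul_one_sub_linSeries c (b 0)
    rw [this]
    exact hG.add (hu.mul (hG.add .one))

theorem one_sub_ratioSeries_succ (a b : ℕ → Fin k → ℝ) (M : ℕ) :
    1 - ratioSeries a b (M + 1) =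
      (1 - ratioSeries (fun i => a (i + 1)) (fun i => b (i + 1)) M) +
        linSeries (b 0 - a 0) *
          (geomSeries (a 0) * ratioSeries (fun i => a (i + 1)) (fun i => b (i + 1)) M) := by
  rw [ratioSeries_succ, linSeries_sub]
  linear_combination -ratioSeries (fun i => a (i + 1)) (fun i => b (i + 1)) M *
    one_sub_linSeries_mul_geomSeries (a 0)

theorem coeffNonneg_one_sub_ratioSeries (M : ℕ) (a b : ℕ → Fin k → ℝ)
    (ha : ∀ i, 0 ≤ a i) (hab : ∀ i, a i ≤ b i) (hba : ∀ i, b (i + 1) ≤ a i) :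
    CoeffNonneg (1 - ratioSeries a b M) := by
  induction M generalizing a b with
  | zero =>
    rw [ratioSeries, Finset.prod_range_zero, sub_self]
    exact .zero
  | succ M ih =>
    rw [one_sub_ratioSeries_succ]
    refine (ih _ _ (fun i => ha _) (fun i => hab _) fun i => hba _).add
      ((coeffNonneg_linSeries (sub_nonneg.2 (hab 0))).mul ?_)
    have := (coeffNonneg_geomSeries_mul_ratioSeries M (fun i => a (i + 1)) (fun i => b (i + 1))
      (a 0) (hba 0) (fun i => ha _) (fun i => hab _) (fun i => hba _)).add .one
    rwa [sub_add_cancel] at this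

/-- The coefficients of `1 - ∏_{i < M} (1 - e(bᵢ)) / (1 - e(aᵢ))` are bounded below by a positive
constant, uniformly in `M ≥ 2`, if the sequence `b₀, a₀, b₁, a₁, …` is decreasing. -/
theorem exists_pos_le_coeff_one_sub_ratioSeries (a b : ℕ → Fin k → ℝ)
    (ha : ∀ i j, 0 < a i j) (hab : ∀ i j, a i j < b i j) (hba : ∀ i j, b (i + 1) j < a i j)
    {d : Fin k →₀ ℕ} (hd : d ≠ 0) :
    ∃ ε > 0, ∀ M, ε ≤ (PowerSeries.coeff (weight d) (1 - ratioSeries a b (M + 2))).coeff d := by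
  have ha' : ∀ i, 0 ≤ a i := fun i j => (ha i j).le
  have hab' : ∀ i, a i ≤ b i := fun i j => (hab i j).le
  have hba' : ∀ i, b (i + 1) ≤ a i := fun i j => (hba i j).le
  have hu : CoeffNonneg (linSeries (a 0 - b 1) * geomSeries (a 0)) :=
    (coeffNonneg_linSeries (sub_nonneg.2 (hba' 0))).mul (coeffNonneg_geomSeries (ha' 0))
  -- The bound is the part of the expansion that involves only `b 0`, `a 0` and `b 1`, hence not
  -- `M`. The inequalities `b 1 < a 0 < b 0` make it strictly positive.
  refine ⟨(PowerSeries.coeff (weight d) (linSeries (b 0 - a 0) *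
      (1 + linSeries (a 0 - b 1) * geomSeries (a 0)))).coeff d, ?_, fun M => ?_⟩
  · refine coeff_linSeries_mul_pos (fun j => sub_pos.2 (hab 0 j)) (CoeffNonneg.one.add hu) ?_ hd
    exact coeffPos_one_add_linSeries_mul (fun j => sub_pos.2 (hba 0 j))
      (coeffNonneg_geomSeries (ha' 0)) (coeffPos_geomSeries (ha 0))
  · have hG := coeffNonneg_geomSeries_mul_ratioSeries M (fun i => a (i + 2)) (fun i => b (i + 2))
      (a 1) (hba' 1) (fun i => ha' _) (fun i => hab' _) (fun i => hba' _)
    have hH := coeffNonneg_one_sub_ratioSeries (M + 1) (fun i => a (i + 1)) (fun i => b (i + 1))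
      (fun i => ha' _) (fun i => hab' _) (fun i => hba' _)
    have key : 1 - ratioSeries a b (M + 2) = linSeries (b 0 - a 0) *
        (1 + linSeries (a 0 - b 1) * geomSeries (a 0)) +
        ((1 - ratioSeries (fun i => a (i + 1)) (fun i => b (i + 1)) (M + 1)) +
          linSeries (b 0 - a 0) * ((1 + linSeries (a 0 - b 1) * geomSeries (a 0)) *
          (geomSeries (a 1) * ratioSeries (fun i => a (i + 2)) (fun i => b (i + 2)) M - 1))) := by
      rw [one_sub_ratioSeries_succ, ratioSeries_succ (fun i => a (i + 1)),
        ← geomSeries_mul_one_sub_linSeries]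
      ring
    rw [key, map_add, MvPolynomial.coeff_add]
    exact le_add_of_nonneg_right (hH.add ((coeffNonneg_linSeries (sub_nonneg.2 (hab' 0))).mul
      ((CoeffNonneg.one.add hu).mul hG)) _ _)

end HirzebruchL

end

/-! ### Passage from the variables `p_j` to elementary symmetric polynomials. -/

noncomputable section

namespace HirzebruchL

/-- The product `q(z₁ s) ⋯ q(z_k s)` as a power series in `s`. -/
def rootProd {K : Type*} [CommRing K] (k : ℕ) (q : PowerSeries K) :
    PowerSeries (MvPolynomial (Fin k) K) :=
  ∏ i : Fin k, PowerSeries.rescale (MvPolynomial.X i) (PowerSeries.map MvPolynomial.C q)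

section

variable {K : Type*} [CommRing K] (k : ℕ)

theorem rootProd_one : rootProd k (1 : PowerSeries K) = 1 := by simp [rootProd]

theorem rootProd_mul (q r : PowerSeries K) :
    rootProd k (q * r) = rootProd k q * rootProd k r := by
  simp [rootProd, Finset.prod_mul_distrib]

theorem coeff_rootProd (n : ℕ) (q : PowerSeries K) :
    PowerSeries.coeff n (rootProd k q) = ∑ f ∈ Finset.finsuppAntidiag Finset.univ n,
      MvPolynomial.C (∏ i : Fin k, PowerSeries.coeff (f i) q) *
        ∏ i : Fin k, MvPolynomial.X i ^ f i := by
  classical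
  rw [rootProd, PowerSeries.coeff_prod]
  refine Finset.sum_congr (by congr) fun f _ => ?_
  simp only [PowerSeries.coeff_rescale, PowerSeries.coeff_map, Finset.prod_mul_distrib, map_prod]
  rw [mul_comm]

theorem map_coeff_rootProd {L : Type*} [CommRing L] (φ : K →+* L) (n : ℕ) (q : PowerSeries K) :
    MvPolynomial.map φ (PowerSeries.coeff n (rootProd k q)) =
      PowerSeries.coeff n (rootProd k (PowerSeries.map φ q)) := by
  simp [coeff_rootProd, map_prod]

/-- Each `zᵢ` enters `rootProd` only through `zᵢ s`, so the exponent of `s` records the total degree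
in the `zᵢ`. -/
theorem homogeneousComponent_prod_aeval_trunc (q : PowerSeries K) :
    MvPolynomial.homogeneousComponent k
      (∏ i : Fin k, Polynomial.aeval (MvPolynomial.X i : MvPolynomial (Fin k) K)
        (PowerSeries.trunc (k + 1) q)) = PowerSeries.coeff k (rootProd k q) := by
  classical
  have hq : ∀ i : Fin k, Polynomial.aeval (MvPolynomial.X i : MvPolynomial (Fin k) K)
      (PowerSeries.trunc (k + 1) q) = ∑ n ∈ Finset.range (k + 1),
        MvPolynomial.C (PowerSeries.coeff n q) * MvPolynomial.X i ^ n := fun i => by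
    rw [PowerSeries.trunc_apply, map_sum, Nat.Ico_zero_eq_range]
    simp [Polynomial.aeval_monomial, MvPolynomial.algebraMap_eq]
  have hterm : ∀ f : Fin k → ℕ, MvPolynomial.homogeneousComponent k
      (∏ i, MvPolynomial.C (PowerSeries.coeff (f i) q) *
        (MvPolynomial.X i : MvPolynomial (Fin k) K) ^ f i) =
      if k = ∑ i, f i then MvPolynomial.C (∏ i : Fin k, PowerSeries.coeff (f i) q) *
        ∏ i : Fin k, MvPolynomial.X i ^ f i else 0 := fun f => by
    rw [Finset.prod_mul_distrib, ← map_prod]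
    refine MvPolynomial.homogeneousComponent_of_mem ?_
    rw [MvPolynomial.mem_homogeneousSubmodule, ← zero_add (∑ i, f i)]
    exact (MvPolynomial.isHomogeneous_C _ _).mul
      (MvPolynomial.IsHomogeneous.prod _ _ _ fun i _ => MvPolynomial.isHomogeneous_X_pow i (f i))
  simp only [hq]
  rw [Finset.prod_univ_sum, map_sum, coeff_rootProd]
  simp only [hterm]
  rw [← Finset.sum_filter]
  refine Finset.sum_bij' (fun f _ => Finsupp.equivFunOnFinite.symm f) (fun f _ => ⇑f) ?_ ?_ ?_ ?_ ?_
  · intro f hf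
    rw [Finset.mem_filter] at hf
    rw [Finset.mem_finsuppAntidiag]
    exact ⟨hf.2.symm, Finset.subset_univ _⟩
  · intro f hf
    rw [Finset.mem_finsuppAntidiag] at hf
    rw [Finset.mem_filter, Fintype.mem_piFinset]
    refine ⟨fun i => ?_, hf.1.symm⟩
    rw [Finset.mem_range, Nat.lt_succ_iff]
    exact (Finset.single_le_sum (f := fun i => f i) (fun _ _ => Nat.zero_le _)
      (Finset.mem_univ i)).trans_eq hf.1
  · intros; rfl
  · intros; ext; rfl
  · intros; rfl

/-- Replaces `p_j` by the `j`-th elementary symmetric polynomial. -/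
def elemHom (K : Type*) [CommRing K] (k : ℕ) :
    MvPolynomial (Fin k) K →ₐ[K] MvPolynomial (Fin k) K :=
  MvPolynomial.aeval fun j : Fin k => MvPolynomial.esymm (Fin k) K ((j : ℕ) + 1)

theorem elemHom_X (j : Fin k) :
    elemHom K k (MvPolynomial.X j) = MvPolynomial.esymm (Fin k) K ((j : ℕ) + 1) :=
  MvPolynomial.aeval_X _ _

theorem elemHom_injective : Function.Injective (elemHom K k) := by
  intro p q hpq
  refine MvPolynomial.esymmAlgHom_injective (σ := Fin k) K (n := k) (Fintype.card_fin k).ge ?_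
  refine Subtype.ext ?_
  rw [MvPolynomial.esymmAlgHom_apply, MvPolynomial.esymmAlgHom_apply]
  exact hpq

theorem elemHom_map {L : Type*} [CommRing L] (φ : K →+* L) (p : MvPolynomial (Fin k) K) :
    elemHom L k (MvPolynomial.map φ p) = MvPolynomial.map φ (elemHom K k p) := by
  induction p using MvPolynomial.induction_on with
  | C a => simp [elemHom]
  | add p q hp hq => simp [hp, hq]
  | mul_X p i hp => simp [hp, elemHom_X, MvPolynomial.map_esymm]

theorem elemHom_LPolynomial : elemHom ℚ k (LPolynomial k) = symmetricPart k := by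
  have h : MvPolynomial.esymmAlgEquiv (Fin k) ℚ (Fintype.card_fin k) (LPolynomial k) =
      ⟨symmetricPart k, symmetricPart_isSymmetric k⟩ := by
    rw [LPolynomial, AlgEquiv.apply_symm_apply]
  have h' := congrArg Subtype.val h
  exact (MvPolynomial.esymmAlgHom_apply (σ := Fin k) (n := k) (LPolynomial k)).symm.trans h'

theorem elemHom_map_LPolynomial :
    elemHom ℝ k (MvPolynomial.map (algebraMap ℚ ℝ) (LPolynomial k)) =
      PowerSeries.coeff k (rootProd k (PowerSeries.map (algebraMap ℚ ℝ) charSeries)) := by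
  rw [elemHom_map, elemHom_LPolynomial, symmetricPart, homogeneousComponent_prod_aeval_trunc,
    map_coeff_rootProd]

/-- Changes the signs of all variables. -/
def negHom (k : ℕ) : MvPolynomial (Fin k) ℝ →ₐ[ℝ] MvPolynomial (Fin k) ℝ :=
  MvPolynomial.aeval fun j => -MvPolynomial.X j

theorem coeff_negHom (p : MvPolynomial (Fin k) ℝ) (d : Fin k →₀ ℕ) :
    (negHom k p).coeff d = (-1) ^ d.degree * p.coeff d := by
  classical
  induction p using MvPolynomial.induction_on' with
  | monomial e a =>
    have : negHom k (MvPolynomial.monomial e a) =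
        MvPolynomial.monomial e ((-1) ^ e.degree * a) := by
      rw [negHom, MvPolynomial.aeval_monomial, MvPolynomial.monomial_eq, Finsupp.prod,
        Finsupp.prod, Finsupp.degree_apply, map_mul, map_pow, map_neg, map_one,
        ← Finset.prod_pow_eq_pow_sum, MvPolynomial.algebraMap_eq, mul_comm _ (MvPolynomial.C a),
        mul_assoc, ← Finset.prod_mul_distrib]
      simp only [← mul_pow, neg_one_mul]
    rw [this, MvPolynomial.coeff_monomial, MvPolynomial.coeff_monomial]
    split_ifs with h
    · rw [h]
    · simp
  | add p q hp hq => rw [map_add, MvPolynomial.coeff_add, hp, hq, MvPolynomial.coeff_add, mul_add]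

/-- Replaces `p_j` by the negative of the `j`-th elementary symmetric polynomial. -/
def negElemHom (k : ℕ) : MvPolynomial (Fin k) ℝ →+* MvPolynomial (Fin k) ℝ :=
  ((elemHom ℝ k).comp (negHom k)).toRingHom

theorem rootProd_one_add_mul_X (x : K) :
    rootProd k (1 + PowerSeries.C x * PowerSeries.X) = 1 + ∑ j : Fin k,
      PowerSeries.monomial ((j : ℕ) + 1)
        (MvPolynomial.C (x ^ ((j : ℕ) + 1)) * MvPolynomial.esymm (Fin k) K ((j : ℕ) + 1)) := by
  classical
  have h : ∀ i : Fin k, PowerSeries.rescale (MvPolynomial.X i : MvPolynomial (Fin k) K)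
      (PowerSeries.map MvPolynomial.C (1 + PowerSeries.C x * PowerSeries.X)) =
      1 + PowerSeries.monomial 1 (MvPolynomial.C x * MvPolynomial.X i) := fun i => by
    ext1 n
    rw [PowerSeries.coeff_rescale, PowerSeries.coeff_map, map_add, map_add, map_add,
      PowerSeries.coeff_monomial, PowerSeries.coeff_C_mul, PowerSeries.coeff_X,
      PowerSeries.coeff_one, PowerSeries.coeff_one]
    split_ifs <;> simp_all [mul_comm]
  have hmon : ∀ t : Finset (Fin k), ∏ i ∈ t, PowerSeries.monomial 1
      (MvPolynomial.C x * (MvPolynomial.X i : MvPolynomial (Fin k) K)) =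
      PowerSeries.monomial t.card (MvPolynomial.C (x ^ t.card) * ∏ i ∈ t, MvPolynomial.X i) := by
    intro t
    induction t using Finset.induction_on with
    | empty => simp
    | insert i t hi ih =>
      rw [Finset.prod_insert hi, ih, PowerSeries.monomial_mul_monomial, Finset.card_insert_of_notMem hi,
        Finset.prod_insert hi, add_comm 1]
      congr 1
      rw [pow_succ, map_mul]
      ring
  simp only [rootProd, h]
  rw [Finset.prod_one_add, Finset.sum_powerset, Finset.card_fin, Finset.sum_range_succ', add_comm]
  congr 1
  · simp
  · rw [Fin.sum_univ_eq_sum_range (fun j => PowerSeries.monomial (j + 1)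
      (MvPolynomial.C (x ^ (j + 1)) * MvPolynomial.esymm (Fin k) K (j + 1)))]
    refine Finset.sum_congr rfl fun n _ => ?_
    rw [MvPolynomial.esymm, Finset.mul_sum, map_sum]
    refine Finset.sum_congr rfl fun t ht => ?_
    rw [hmon, (Finset.mem_powersetCard.1 ht).2]

/-- The sequence of powers `x, x², …, x^k`. -/
def powers (k : ℕ) (x : ℝ) (j : Fin k) : ℝ := x ^ ((j : ℕ) + 1)

/-- The minus sign that makes `1 - linSeries` suitable for geometric series is the one undone by
`negElemHom`; what remains is Vieta's formula. -/
theorem map_negElemHom_one_sub_linSeries (x : ℝ) :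
    PowerSeries.map (negElemHom k) (1 - linSeries (powers k x)) =
      rootProd k (1 + PowerSeries.C x * PowerSeries.X) := by
  rw [rootProd_one_add_mul_X, map_sub, map_one, sub_eq_add_neg, linSeries, map_sum,
    ← Finset.sum_neg_distrib]
  congr 1
  refine Finset.sum_congr rfl fun j _ => ?_
  ext1 n
  rw [map_neg, PowerSeries.coeff_map, PowerSeries.coeff_monomial, PowerSeries.coeff_monomial]
  split_ifs
  · rw [← MvPolynomial.C_mul_X_eq_monomial]
    have hn : negHom k (MvPolynomial.X j) = -MvPolynomial.X j := MvPolynomial.aeval_X _ _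
    have hC : ∀ r, negHom k (MvPolynomial.C r) = MvPolynomial.C r := MvPolynomial.aeval_C _
    have hC' : ∀ r, elemHom ℝ k (MvPolynomial.C r) = MvPolynomial.C r := MvPolynomial.aeval_C _
    change -elemHom ℝ k (negHom k _) = _
    rw [map_mul, map_mul, hn, hC, hC', map_neg, elemHom_X, mul_neg, neg_neg, powers]
  · simp

theorem one_add_mul_X_mul_inv (x : ℝ) :
    (1 + PowerSeries.C x * PowerSeries.X) * (1 + PowerSeries.C x * PowerSeries.X)⁻¹ = 1 :=
  PowerSeries.mul_inv_cancel _ (by simp)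

theorem map_negElemHom_geomSeries (x : ℝ) :
    PowerSeries.map (negElemHom k) (geomSeries (powers k x)) =
      rootProd k (1 + PowerSeries.C x * PowerSeries.X)⁻¹ := by
  have h1 := congrArg (PowerSeries.map (negElemHom k))
    (one_sub_linSeries_mul_geomSeries (powers k x))
  rw [map_mul, map_negElemHom_one_sub_linSeries, map_one] at h1
  have h2 := congrArg (rootProd k) (one_add_mul_X_mul_inv x)
  rw [rootProd_mul, rootProd_one] at h2
  linear_combination rootProd k (1 + PowerSeries.C x * PowerSeries.X)⁻¹ * h1 -
    PowerSeries.map (negElemHom k) (geomSeries (powers k x)) * h2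

/-- The rational function `∏_{i < M} (1 + bᵢ z) / (1 + aᵢ z)`. -/
def ratio (a b : ℕ → ℝ) (M : ℕ) : PowerSeries ℝ :=
  ∏ i ∈ Finset.range M, (1 + PowerSeries.C (b i) * PowerSeries.X) *
    (1 + PowerSeries.C (a i) * PowerSeries.X)⁻¹

theorem rootProd_ratio (a b : ℕ → ℝ) (M : ℕ) :
    rootProd k (ratio a b M) = PowerSeries.map (negElemHom k)
      (ratioSeries (fun i => powers k (a i)) (fun i => powers k (b i)) M) := by
  induction M with
  | zero => simp [ratio, ratioSeries, rootProd_one]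
  | succ M ih =>
    rw [ratio, Finset.prod_range_succ, ← ratio, rootProd_mul, ih, rootProd_mul,
      ← map_negElemHom_geomSeries, ← map_negElemHom_one_sub_linSeries, ← map_mul, ← map_mul,
      ratioSeries, ratioSeries, Finset.prod_range_succ]

theorem weight_partitionExponent {k : ℕ} (J : k.Partition) : weight (partitionExponent J) = k := by
  rw [weight, Finsupp.sum_fintype _ _ (by simp)]
  have h : J.parts.sum = ∑ i ∈ Finset.range (k + 1), J.parts.count i • i :=
    Finset.sum_multiset_count_of_subset _ _ fun i hi => by
      rw [Finset.mem_range, Nat.lt_succ_iff]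
      exact J.le_of_mem_parts (Multiset.mem_toFinset.1 hi)
  rw [J.parts_sum, Finset.sum_range_succ', smul_zero, add_zero] at h
  conv_rhs => rw [h]
  rw [← Fin.sum_univ_eq_sum_range (fun i => J.parts.count (i + 1) • (i + 1))]
  rfl

theorem degree_partitionExponent {k : ℕ} (J : k.Partition) :
    (partitionExponent J).degree = Multiset.card J.parts := by
  rw [Finsupp.degree_eq_sum, ← Multiset.sum_count_eq_card (s := Finset.range (k + 1)),
    Finset.sum_range_succ', Multiset.count_eq_zero.2 (fun h => (J.parts_pos h).ne rfl), add_zero,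
    ← Fin.sum_univ_eq_sum_range (fun i => J.parts.count (i + 1))]
  · rfl
  · intro i hi
    rw [Finset.mem_range, Nat.lt_succ_iff]
    exact J.le_of_mem_parts hi

/-- If rational functions `∏_{i < M} (1 + bᵢ z) / (1 + aᵢ z)` tend to `Q` coefficientwise, then
the coefficients of the Hirzebruch polynomials are the limits of their analogues. -/
theorem tendsto_coeff_ratioSeries {k : ℕ} (J : k.Partition) (a b : ℕ → ℝ)
    (hab : ∀ n, Filter.Tendsto (fun M => PowerSeries.coeff n (ratio a b M)) Filter.atTop
      (nhds ((PowerSeries.coeff n charSeries : ℚ) : ℝ))) :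
    Filter.Tendsto (fun M => (-1) ^ Multiset.card J.parts *
      (PowerSeries.coeff k (ratioSeries (fun i => powers k (a i)) (fun i => powers k (b i)) M)).coeff
        (partitionExponent J)) Filter.atTop (nhds ((h J : ℚ) : ℝ)) := by
  -- A linear left inverse on all polynomials lets the coefficient of `p_J` be read off by one
  -- linear functional, with no need to check symmetry.
  obtain ⟨ψ, hψ⟩ := LinearMap.exists_leftInverse_of_injective (elemHom ℝ k).toLinearMap
    (LinearMap.ker_eq_bot.2 (elemHom_injective k))
  have hψ' : ∀ p, ψ (elemHom ℝ k p) = p := fun p => LinearMap.congr_fun hψ p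
  set φ : MvPolynomial (Fin k) ℝ →ₗ[ℝ] ℝ := (MvPolynomial.lcoeff ℝ (partitionExponent J)).comp ψ
  have hφ : ∀ p, φ (elemHom ℝ k p) = p.coeff (partitionExponent J) := fun p => by
    simp [φ, hψ']
  -- The functional depends polynomially on finitely many coefficients of `q`, so coefficientwise
  -- convergence is enough.
  have hexp : ∀ q : PowerSeries ℝ, φ (PowerSeries.coeff k (rootProd k q)) =
      ∑ f ∈ Finset.finsuppAntidiag Finset.univ k,
        (∏ i : Fin k, PowerSeries.coeff (f i) q) * φ (∏ i : Fin k, MvPolynomial.X i ^ f i) := by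
    intro q
    rw [coeff_rootProd, map_sum]
    refine Finset.sum_congr rfl fun f _ => ?_
    rw [← MvPolynomial.smul_eq_C_mul, map_smul, smul_eq_mul]
  have hh : ((h J : ℚ) : ℝ) = φ (PowerSeries.coeff k
      (rootProd k (PowerSeries.map (algebraMap ℚ ℝ) charSeries))) := by
    rw [← elemHom_map_LPolynomial, hφ, MvPolynomial.coeff_map]
    rfl
  have hM : ∀ M, (-1) ^ Multiset.card J.parts *
      (PowerSeries.coeff k (ratioSeries (fun i => powers k (a i)) (fun i => powers k (b i)) M)).coeff
        (partitionExponent J) = φ (PowerSeries.coeff k (rootProd k (ratio a b M))) := by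
    intro M
    rw [rootProd_ratio, PowerSeries.coeff_map, ← degree_partitionExponent, ← coeff_negHom, ← hφ]
    rfl
  simp only [hM, hh, hexp]
  refine tendsto_finsetSum _ fun f _ => Filter.Tendsto.mul_const _ (tendsto_finsetProd _ fun i _ => ?_)
  rw [PowerSeries.coeff_map]
  exact hab _

end

end HirzebruchL

end

noncomputable section

namespace HirzebruchL

open PowerSeries
open Finset.HasAntidiagonal (antidiagonal mem_antidiagonal)

/-! ### Logarithmic derivatives of formal power series. -/

section LogDeriv

variable {K : Type*} [Field K]

/-- The series `ℓ` is the logarithmic derivative `z f' / f`. -/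
def IsLogDeriv (f l : PowerSeries K) : Prop := X * derivative K f = f * l

theorem IsLogDeriv.one : IsLogDeriv (1 : PowerSeries K) 0 := by
  rw [IsLogDeriv, Derivation.map_one_eq_zero, mul_zero, mul_zero]

theorem IsLogDeriv.mul {f g l m : PowerSeries K} (hf : IsLogDeriv f l) (hg : IsLogDeriv g m) :
    IsLogDeriv (f * g) (l + m) := by
  unfold IsLogDeriv at *
  rw [Derivation.leibniz, smul_eq_mul, smul_eq_mul]
  linear_combination f * hg + g * hf

theorem IsLogDeriv.of_mul_eq_one {f g l : PowerSeries K} (hf : IsLogDeriv f l) (hfg : f * g = 1) :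
    IsLogDeriv g (-l) := by
  unfold IsLogDeriv at *
  have h := congrArg (derivative K) hfg
  rw [Derivation.leibniz, smul_eq_mul, smul_eq_mul, Derivation.map_one_eq_zero] at h
  linear_combination X * g * h - g ^ 2 * hf - (X * derivative K g + g * l) * hfg

theorem IsLogDeriv.map {L : Type*} [Field L] (φ : K →+* L) {f l : PowerSeries K}
    (h : IsLogDeriv f l) : IsLogDeriv (PowerSeries.map φ f) (PowerSeries.map φ l) := by
  have hd : derivative L (PowerSeries.map φ f) = PowerSeries.map φ (derivative K f) := by
    ext n
    simp [coeff_derivative]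
  rw [IsLogDeriv, hd, ← map_X φ, ← map_mul, h, map_mul]

theorem IsLogDeriv.succ_mul_coeff_succ {f l : PowerSeries K} (h : IsLogDeriv f l) (n : ℕ) :
    (n + 1 : K) * coeff (n + 1) f = ∑ p ∈ antidiagonal (n + 1), coeff p.1 f * coeff p.2 l := by
  have hc := congrArg (coeff (n + 1)) h
  rwa [coeff_succ_X_mul, coeff_derivative, coeff_mul, mul_comm] at hc

/-- Coefficientwise convergence of logarithmic derivatives implies that of the series. -/
theorem tendsto_coeff_of_isLogDeriv {f l : ℕ → PowerSeries ℝ} {g m : PowerSeries ℝ}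
    (hf : ∀ M, IsLogDeriv (f M) (l M)) (hg : IsLogDeriv g m)
    (hf0 : ∀ M, coeff 0 (f M) = 1) (hg0 : coeff 0 g = 1)
    (hl0 : ∀ M, coeff 0 (l M) = 0)
    (hlm : ∀ n, Filter.Tendsto (fun M => coeff n (l M)) Filter.atTop (nhds (coeff n m))) (n : ℕ) :
    Filter.Tendsto (fun M => coeff n (f M)) Filter.atTop (nhds (coeff n g)) := by
  have hm0 : coeff 0 m = 0 := by
    refine tendsto_nhds_unique (hlm 0) ?_
    simp only [hl0]
    exact tendsto_const_nhds
  induction n using Nat.strong_induction_on with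
  | _ n ih =>
    cases n with
    | zero =>
      simp only [hf0, hg0]
      exact tendsto_const_nhds
    | succ n =>
      have hn : (n + 1 : ℝ) ≠ 0 := by positivity
      have key : ∀ {u v : PowerSeries ℝ}, IsLogDeriv u v → coeff (n + 1) u =
          (n + 1 : ℝ)⁻¹ * ∑ p ∈ antidiagonal (n + 1), coeff p.1 u * coeff p.2 v := fun h => by
        rw [← h.succ_mul_coeff_succ, inv_mul_cancel_left₀ hn]
      simp only [key (hf _), key hg]
      refine Filter.Tendsto.const_mul _ (tendsto_finsetSum _ fun p hp => ?_)
      rw [mem_antidiagonal] at hp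
      -- The term with `p.2 = 0` would involve the unknown coefficient `n + 1`, but the logarithmic
      -- derivatives have no constant term.
      rcases Nat.eq_zero_or_pos p.2 with h0 | h0
      · simp only [h0, hl0, hm0, mul_zero]
        exact tendsto_const_nhds
      · exact (ih _ (by omega)).mul (hlm _)

theorem isLogDeriv_one_add_mul_X (x : ℝ) :
    IsLogDeriv (1 + C x * X : PowerSeries ℝ) (1 - (1 + C x * X)⁻¹) := by
  have hd : derivative ℝ (1 + C x * X : PowerSeries ℝ) = C x := by
    rw [map_add, Derivation.map_one_eq_zero, Derivation.leibniz, derivative_X, derivative_C]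
    simp
  rw [IsLogDeriv, hd]
  linear_combination one_add_mul_X_mul_inv x

theorem coeff_inv_one_add_mul_X (x : ℝ) (n : ℕ) :
    coeff n (1 + C x * X : PowerSeries ℝ)⁻¹ = (-x) ^ n := by
  have h : ((1 + C x * X : PowerSeries ℝ)⁻¹) = mk fun n => (-x) ^ n := by
    rw [PowerSeries.inv_eq_iff_mul_eq_one (by simp)]
    ext n
    rw [mul_add, mul_one, map_add, ← mul_assoc]
    cases n with
    | zero => simp
    | succ n =>
      rw [coeff_succ_mul_X, coeff_mul_C, coeff_mk, coeff_mk, coeff_one, if_neg n.succ_ne_zero]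
      ring
  rw [h, coeff_mk]

/-- A factor `1 + x z` contributes `1 - 1 / (1 + x z) = -∑_{n ≥ 1} (-x)ⁿ zⁿ`, and logarithmic
derivatives add up. -/
theorem isLogDeriv_ratio (a b : ℕ → ℝ) (M : ℕ) :
    IsLogDeriv (ratio a b M)
      (mk fun n => -(-1) ^ n * ∑ i ∈ Finset.range M, (b i ^ n - a i ^ n)) := by
  induction M with
  | zero =>
    have : (mk fun n => -(-1) ^ n * ∑ i ∈ Finset.range 0, (b i ^ n - a i ^ n)) = 0 := by
      ext; simp
    rw [this, ratio, Finset.prod_range_zero]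
    exact .one
  | succ M ih =>
    rw [ratio, Finset.prod_range_succ, ← ratio]
    have h := ih.mul ((isLogDeriv_one_add_mul_X (b M)).mul
      ((isLogDeriv_one_add_mul_X (a M)).of_mul_eq_one (one_add_mul_X_mul_inv (a M))))
    convert h using 1
    ext n
    simp only [map_add, map_sub, map_neg, coeff_inv_one_add_mul_X, coeff_mk,
      Finset.sum_range_succ]
    rw [neg_pow (a M), neg_pow (b M)]
    ring

theorem coeff_zero_ratio (a b : ℕ → ℝ) (M : ℕ) : coeff 0 (ratio a b M) = 1 := by
  rw [coeff_zero_eq_constantCoeff_apply, ratio, map_prod]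
  refine Finset.prod_eq_one fun i _ => ?_
  rw [map_mul, PowerSeries.constantCoeff_inv]
  simp

end LogDeriv

/-! ### Hyperbolic identities and the logarithmic derivative of `Q`. -/

section CharSeries

/-- The power series `√z / sinh √z`. -/
def cschSeries : PowerSeries ℚ :=
  mk fun n => 4 ^ n * ((Polynomial.bernoulli (2 * n)).eval (1 / 2) / (2 * n).factorial)

/-- The generating function of `Bₙ(1/2)` is `t e^{t/2} / (e^t - 1) = (t/2) / sinh (t/2)`; then `t =
2√z`, which accounts for the factor `4ⁿ`. Here `W` is this series and `T` is `sinh (t/2) / (t/2)`.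
-/
theorem cschSeries_mul_sinhSeries : cschSeries * sinhSeries = 1 := by
  set W : PowerSeries ℚ := mk fun n => (Polynomial.bernoulli n).eval (1 / 2) / n.factorial with hW
  set T : PowerSeries ℚ := mk fun n => if Even n then (1 / 2) ^ n / (n + 1).factorial else 0 with hT
  have hWT : W * T = 1 := by
    have hgen := Polynomial.bernoulli_generating_function (1 / 2 : ℚ)
    have hW' : (mk fun n => Polynomial.aeval (1 / 2 : ℚ)
        ((1 / n.factorial : ℚ) • Polynomial.bernoulli n)) = W := by
      ext n
      rw [coeff_mk, hW, coeff_mk, map_smul, smul_eq_mul, Polynomial.coe_aeval_eq_eval]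
      ring
    rw [hW'] at hgen
    have h1 := exp_mul_exp_eq_exp_add (1 / 2 : ℚ) (1 / 2)
    have h2 := exp_mul_exp_eq_exp_add (1 / 2 : ℚ) (-(1 / 2))
    rw [add_halves, rescale_one, RingHom.id_apply] at h1
    rw [add_neg_cancel, rescale_zero_apply, constantCoeff_exp, map_one] at h2
    have hXT : rescale (1 / 2 : ℚ) (exp ℚ) - rescale (-(1 / 2) : ℚ) (exp ℚ) = X * T := by
      ext n
      rw [map_sub, coeff_rescale, coeff_rescale, coeff_exp]
      cases n with
      | zero => simp
      | succ n =>
        rw [coeff_succ_X_mul, hT, coeff_mk, neg_pow]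
        split_ifs with hn
        · rw [hn.add_one.neg_one_pow]
          simp only [Algebra.algebraMap_self, RingHom.id_apply]
          ring
        · rw [(Nat.not_even_iff_odd.1 hn).add_one.neg_one_pow]
          ring
    refine mul_left_cancel₀ (X_ne_zero (R := ℚ)) ?_
    linear_combination rescale (-(1 / 2) : ℚ) (exp ℚ) * hgen - W * hXT +
      W * rescale (-(1 / 2) : ℚ) (exp ℚ) * h1 -
      (W * rescale (1 / 2 : ℚ) (exp ℚ) - X) * h2
  ext n
  have hn := congrArg (coeff (2 * n)) hWT
  -- As `T` is even, only pairs of even indices contribute to the coefficient of degree `2 * n`.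
  have hsum : coeff n (cschSeries * sinhSeries) = 4 ^ n * coeff (2 * n) (W * T) := by
    rw [coeff_mul, coeff_mul, Finset.mul_sum]
    refine Finset.sum_of_injOn (fun p => (2 * p.1, 2 * p.2)) ?_ ?_ ?_ ?_
    · rintro ⟨a, b⟩ _ ⟨c, d⟩ _ h
      simp only [Prod.mk.injEq] at h ⊢
      omega
    · rintro ⟨a, b⟩ h
      simp only [Finset.mem_coe, mem_antidiagonal] at h ⊢
      omega
    · rintro ⟨a, b⟩ h hne
      rw [mem_antidiagonal] at h
      simp only at h
      have hb : ¬ Even b := fun hb => hne (by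
        obtain ⟨c, rfl⟩ := hb
        refine ⟨(n - c, c), ?_, ?_⟩
        · simp only [Finset.mem_coe, mem_antidiagonal]
          omega
        · simp only [Prod.mk.injEq]
          omega)
      simp [hT, hb]
    · rintro ⟨a, b⟩ h
      rw [mem_antidiagonal] at h
      simp only at h
      subst h
      simp only [cschSeries, sinhSeries, hW, hT, coeff_mk, even_two_mul, if_true]
      rw [pow_add, pow_mul (1 / 2 : ℚ) 2 b, one_div_pow, one_div_pow]
      field_simp
      norm_num
  rw [hsum, hn, coeff_one, coeff_one]
  rcases Nat.eq_zero_or_pos n with rfl | h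
  · simp
  · rw [if_neg (by omega), if_neg (by omega), mul_zero]

theorem two_mul_derivative_coshSeries : 2 * derivative ℚ coshSeries = sinhSeries := by
  ext n
  rw [← map_ofNat C 2, coeff_C_mul, coeff_derivative, coshSeries, sinhSeries, coeff_mk, coeff_mk,
    show 2 * (n + 1) = 2 * n + 1 + 1 by ring, Nat.factorial_succ (2 * n + 1)]
  push_cast
  have : ((2 * n + 1).factorial : ℚ) ≠ 0 := by positivity
  field_simp
  ring

theorem two_mul_X_mul_derivative_sinhSeries :
    2 * (X * derivative ℚ sinhSeries) = coshSeries - sinhSeries := by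
  ext n
  rw [← map_ofNat C 2, coeff_C_mul, map_sub]
  cases n with
  | zero => simp [sinhSeries, coshSeries]
  | succ n =>
    rw [coeff_succ_X_mul, coeff_derivative, sinhSeries, coshSeries, coeff_mk, coeff_mk,
      Nat.factorial_succ (2 * (n + 1))]
    push_cast
    have : ((2 * (n + 1)).factorial : ℚ) ≠ 0 := by positivity
    field_simp
    ring

theorem coeff_zero_sinhSeries : coeff 0 sinhSeries = 1 := by simp [sinhSeries]

theorem coeff_zero_coshSeries : coeff 0 coshSeries = 1 := by simp [coshSeries]

theorem coshSeries_sq_sub : coshSeries ^ 2 - X * sinhSeries ^ 2 = 1 := by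
  refine derivative.ext ?_ ?_
  · have hC := two_mul_derivative_coshSeries
    have hS := two_mul_X_mul_derivative_sinhSeries
    rw [map_sub, Derivation.map_one_eq_zero, Derivation.leibniz, Derivation.leibniz_pow,
      Derivation.leibniz_pow, derivative_X]
    simp only [smul_eq_mul, nsmul_eq_mul, Nat.cast_ofNat]
    linear_combination coshSeries * hC - sinhSeries * hS
  · rw [map_sub, map_mul, map_pow, ← coeff_zero_eq_constantCoeff_apply coshSeries,
      coeff_zero_coshSeries]
    simp

/-- The system `A' = 2 B`, `2 z B' = A - B` has only the trivial solution with `A(0) = 0`. -/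
theorem eq_zero_of_derivative_eq {A B : PowerSeries ℚ} (hA : derivative ℚ A = 2 * B)
    (hB : 2 * (X * derivative ℚ B) = A - B) (h0 : coeff 0 A = 0) : B = 0 := by
  have hB' : ∀ n, (2 * n + 1) * coeff n B = coeff n A := fun n => by
    have h := congrArg (coeff n) hB
    rw [← map_ofNat C 2, coeff_C_mul, map_sub] at h
    cases n with
    | zero => simp at h ⊢; linarith
    | succ n =>
      rw [coeff_succ_X_mul, coeff_derivative] at h
      push_cast
      linarith
  have hA' : ∀ n, coeff (n + 1) A * (n + 1) = 2 * coeff n B := fun n => by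
    have h := congrArg (coeff n) hA
    rwa [← map_ofNat C 2, coeff_C_mul, coeff_derivative] at h
  have hn : ∀ n, coeff n A = 0 := by
    intro n
    induction n with
    | zero => exact h0
    | succ n ih =>
      have h1 := hB' n
      rw [ih] at h1
      have h2 := hA' n
      rw [(mul_eq_zero.1 h1).resolve_left (by positivity), mul_zero] at h2
      exact (mul_eq_zero.1 h2).resolve_right (by positivity)
  ext n
  have h1 := hB' n
  rw [hn] at h1
  simpa using (mul_eq_zero.1 h1).resolve_left (by positivity)

theorem derivative_rescale (a : ℚ) (f : PowerSeries ℚ) :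
    derivative ℚ (rescale a f) = C a * rescale a (derivative ℚ f) := by
  ext n
  rw [coeff_derivative, coeff_rescale, coeff_C_mul, coeff_rescale, coeff_derivative]
  ring

theorem X_mul_derivative_rescale (a : ℚ) (f : PowerSeries ℚ) :
    X * derivative ℚ (rescale a f) = rescale a (X * derivative ℚ f) := by
  rw [derivative_rescale, map_mul, rescale_X]
  ring

/-- This is `sinh 2t = 2 sinh t cosh t` with `t = √z`. Its defect and that of `cosh 2t = 1 + 2 sinh²
t` together satisfy the linear system of `eq_zero_of_derivative_eq`. -/
theorem coshSeries_mul_sinhSeries : coshSeries * sinhSeries = rescale 4 sinhSeries := by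
  have hC := two_mul_derivative_coshSeries
  have hS := two_mul_X_mul_derivative_sinhSeries
  have h1 := coshSeries_sq_sub
  have hC4 : derivative ℚ (rescale 4 coshSeries) = 2 * rescale 4 sinhSeries := by
    rw [derivative_rescale, ← hC, map_mul, map_ofNat, map_ofNat]
    ring
  have hS4 : 2 * (X * derivative ℚ (rescale 4 sinhSeries)) =
      rescale 4 coshSeries - rescale 4 sinhSeries := by
    rw [X_mul_derivative_rescale, ← map_sub, ← hS, map_mul (rescale 4) 2, map_ofNat]
  refine sub_eq_zero.1 (eq_zero_of_derivative_eq
    (A := 1 + (X * sinhSeries ^ 2 + X * sinhSeries ^ 2) - rescale 4 coshSeries) ?_ ?_ ?_)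
  · rw [map_sub, hC4, map_add, map_add, Derivation.map_one_eq_zero, Derivation.leibniz,
      Derivation.leibniz_pow, derivative_X]
    simp only [smul_eq_mul, nsmul_eq_mul, Nat.cast_ofNat]
    linear_combination 2 * sinhSeries * hS
  · rw [map_sub, Derivation.leibniz, smul_eq_mul, smul_eq_mul]
    linear_combination X * sinhSeries * hC + coshSeries * hS - hS4 + h1
  · rw [coeff_zero_eq_constantCoeff_apply, map_sub,
      ← coeff_zero_eq_constantCoeff_apply (rescale 4 coshSeries), coeff_rescale,
      coeff_zero_coshSeries]
    simp

/-- With `t = √z`, `z Q'/Q = 1/2 + (t/2)(tanh t - coth t) = (1/2)(1 - 2t / sinh 2t)`. -/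
theorem isLogDeriv_charSeries :
    IsLogDeriv charSeries (C (1 / 2) * (1 - rescale 4 cschSeries)) := by
  have hC := two_mul_derivative_coshSeries
  have hS := two_mul_X_mul_derivative_sinhSeries
  have h1 := coshSeries_sq_sub
  have hS0 : sinhSeries ≠ 0 := fun h => by simpa [h] using coeff_zero_sinhSeries
  have hV := congrArg (rescale (4 : ℚ)) cschSeries_mul_sinhSeries
  rw [map_mul, map_one, ← coshSeries_mul_sinhSeries] at hV
  have hQ : charSeries * sinhSeries = coshSeries := by
    rw [charSeries, mul_assoc, PowerSeries.inv_mul_cancel, mul_one]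
    rw [← coeff_zero_eq_constantCoeff_apply, coeff_zero_sinhSeries]
    exact one_ne_zero
  have hQ' := congrArg (derivative ℚ) hQ
  rw [Derivation.leibniz, smul_eq_mul, smul_eq_mul] at hQ'
  have h2 : (2 : PowerSeries ℚ) * C (1 / 2) = 1 := by
    rw [← map_ofNat C 2, ← map_mul]
    norm_num
  have h20 : (2 : PowerSeries ℚ) ≠ 0 := left_ne_zero_of_mul_eq_one h2
  refine mul_left_cancel₀ (mul_ne_zero h20 (mul_ne_zero hS0 hS0)) ?_
  linear_combination 2 * X * sinhSeries * hQ' + X * sinhSeries * hC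
    - sinhSeries * charSeries * hS - (coshSeries - sinhSeries) * hQ
    - (1 - rescale 4 cschSeries) * sinhSeries ^ 2 * charSeries * h2
    - (1 - rescale 4 cschSeries) * sinhSeries * hQ + hV - h1

theorem coeff_zero_charSeries : coeff 0 charSeries = 1 := by
  rw [coeff_zero_eq_constantCoeff_apply, charSeries, map_mul, PowerSeries.constantCoeff_inv,
    ← coeff_zero_eq_constantCoeff_apply, ← coeff_zero_eq_constantCoeff_apply,
    coeff_zero_sinhSeries, coeff_zero_coshSeries, inv_one, mul_one]

end CharSeries

end HirzebruchL

end

/-! ### Convergence of the finite products to `Q`, and the sign of `h_J`. -/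

noncomputable section

namespace HirzebruchL

theorem sum_range_alternating (f : ℕ → ℝ) (h0 : f 0 = 0) (M : ℕ) :
    ∑ m ∈ Finset.range (2 * M + 1), (-1) ^ m * f m =
      -∑ i ∈ Finset.range M, (f (2 * i + 1) - f (2 * i + 2)) := by
  induction M with
  | zero => simp [h0]
  | succ M ih =>
    rw [show 2 * (M + 1) + 1 = 2 * M + 1 + 1 + 1 by ring, Finset.sum_range_succ,
      Finset.sum_range_succ, ih, Finset.sum_range_succ]
    have h1 : (-1 : ℝ) ^ (2 * M + 1) = -1 := (odd_two_mul_add_one M).neg_one_pow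
    have h2 : (-1 : ℝ) ^ (2 * M + 1 + 1) = 1 := (odd_two_mul_add_one M).add_one.neg_one_pow
    rw [h1, h2]
    ring

theorem tendsto_alternating_zeta {n : ℕ} (hn : n ≠ 0) :
    Filter.Tendsto (fun M => ∑ i ∈ Finset.range M,
      (1 / ((2 * i + 1 : ℕ) : ℝ) ^ (2 * n) - 1 / ((2 * i + 2 : ℕ) : ℝ) ^ (2 * n))) Filter.atTop
      (nhds ((-1) ^ n * (2 * Real.pi) ^ (2 * n) / 2 / (2 * n).factorial *
        ((Polynomial.bernoulli (2 * n)).eval (1 / 2) : ℚ))) := by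
  -- The Fourier series of `B_{2n}` at `1/2` has `cos (π m) = (-1)^m`. Its term `m = 0` vanishes
  -- because `1 / 0 = 0`, so the first `2 * M + 1` terms form `M` pairs.
  have h := (hasSum_one_div_nat_pow_mul_cos hn
    (show (1 / 2 : ℝ) ∈ Set.Icc (0 : ℝ) 1 by constructor <;> norm_num)).tendsto_sum_nat
  have h' := (h.comp (Filter.tendsto_atTop_mono (fun M : ℕ => (by omega : M ≤ 2 * M + 1))
    Filter.tendsto_id)).neg
  convert h' using 1
  · ext M
    have hc : ∀ m : ℕ, 1 / (m : ℝ) ^ (2 * n) * Real.cos (2 * Real.pi * m * (1 / 2)) =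
        (-1) ^ m * (1 / (m : ℝ) ^ (2 * n)) := fun m => by
      rw [show 2 * Real.pi * m * (1 / 2) = m * Real.pi by ring, Real.cos_nat_mul_pi, mul_comm]
    simp only [Function.comp_apply, hc]
    rw [sum_range_alternating (fun m => 1 / (m : ℝ) ^ (2 * n)) (by simp [hn]), neg_neg]
  · have he : (Polynomial.map (algebraMap ℚ ℝ) (Polynomial.bernoulli (2 * n))).eval (1 / 2) =
        (((Polynomial.bernoulli (2 * n)).eval (1 / 2) : ℚ) : ℝ) := by
      have := Polynomial.eval_map_apply (f := algebraMap ℚ ℝ)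
        (p := Polynomial.bernoulli (2 * n)) (1 / 2)
      simpa using this
    rw [he, pow_succ]
    congr 1
    ring

/-- The negatives `4 / (π² (2 * i + 1)²)` of the inverse zeros of `cosh √z`. -/
def coshRoot (i : ℕ) : ℝ := 4 / Real.pi ^ 2 * (1 / ((2 * i + 1 : ℕ) : ℝ) ^ 2)

/-- The negatives `4 / (π² (2 * i + 2)²)` of the inverse zeros of `sinh √z / √z`. -/
def sinhRoot (i : ℕ) : ℝ := 4 / Real.pi ^ 2 * (1 / ((2 * i + 2 : ℕ) : ℝ) ^ 2)

theorem tendsto_coeff_ratio (n : ℕ) :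
    Filter.Tendsto (fun M => PowerSeries.coeff n (ratio sinhRoot coshRoot M)) Filter.atTop
      (nhds ((PowerSeries.coeff n charSeries : ℚ) : ℝ)) := by
  have h := tendsto_coeff_of_isLogDeriv (isLogDeriv_ratio sinhRoot coshRoot)
    (isLogDeriv_charSeries.map (algebraMap ℚ ℝ)) (coeff_zero_ratio _ _)
    (by rw [PowerSeries.coeff_map, coeff_zero_charSeries, map_one]) (fun M => by simp)
    (fun n => ?_) n
  · simpa using h
  · rw [PowerSeries.coeff_map, PowerSeries.coeff_C_mul, map_sub, PowerSeries.coeff_rescale,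
      PowerSeries.coeff_one, cschSeries, PowerSeries.coeff_mk]
    simp only [PowerSeries.coeff_mk]
    rcases eq_or_ne n 0 with rfl | hn
    · simp
    · have hz := (tendsto_alternating_zeta hn).const_mul (-(-1) ^ n * (4 / Real.pi ^ 2) ^ n)
      convert hz using 1
      · ext M
        rw [mul_assoc, Finset.mul_sum (Finset.range M) _ ((4 / Real.pi ^ 2) ^ n)]
        congr 1
        refine Finset.sum_congr rfl fun i _ => ?_
        rw [coshRoot, sinhRoot, mul_pow, mul_pow, one_div_pow, one_div_pow, ← pow_mul, ← pow_mul]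
        ring
      · rw [if_neg hn]
        congr 1
        have hs : ((-1 : ℝ) ^ n) * (-1) ^ n = 1 := by rw [← mul_pow]; norm_num
        -- One factor `4 ^ n` comes from `rescale 4`, the other from `cschSeries`.
        have hp : (4 / Real.pi ^ 2) ^ n * (2 * Real.pi) ^ (2 * n) = 4 ^ n * 4 ^ n := by
          rw [pow_mul, ← mul_pow, ← mul_pow]
          congr 1
          field_simp
          norm_num
        simp only [eq_ratCast]
        push_cast
        linear_combination (1 / 2 / (2 * n).factorial *
          ((Polynomial.bernoulli (2 * n)).eval (1 / 2) : ℚ)) * hp +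
          (1 / 2 / (2 * n).factorial * (4 / Real.pi ^ 2) ^ n * (2 * Real.pi) ^ (2 * n) *
          ((Polynomial.bernoulli (2 * n)).eval (1 / 2) : ℚ)) * hs

theorem sinhRoot_pos (i : ℕ) : 0 < sinhRoot i := by
  rw [sinhRoot]
  positivity

theorem sinhRoot_lt_coshRoot (i : ℕ) : sinhRoot i < coshRoot i := by
  rw [sinhRoot, coshRoot]
  have : ((2 * i + 1 : ℕ) : ℝ) < ((2 * i + 2 : ℕ) : ℝ) := by exact_mod_cast Nat.lt_succ_self _
  gcongr

theorem coshRoot_succ_lt_sinhRoot (i : ℕ) : coshRoot (i + 1) < sinhRoot i := by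
  rw [sinhRoot, coshRoot]
  have : ((2 * i + 2 : ℕ) : ℝ) < ((2 * (i + 1) + 1 : ℕ) : ℝ) := by
    exact_mod_cast Nat.lt_succ_self _
  gcongr

theorem powers_strictMono {k : ℕ} {x y : ℝ} (hx : 0 ≤ x) (hxy : x < y) (j : Fin k) :
    powers k x j < powers k y j :=
  pow_lt_pow_left₀ hxy hx (Nat.succ_ne_zero _)

/-- The coefficient `h_J` has sign `(-1)^(r+1)`, where `r` is the number of parts of `J`. -/
theorem neg_one_pow_mul_h_neg {k : ℕ} (hk : 1 ≤ k) (J : k.Partition) :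
    (-1) ^ Multiset.card J.parts * ((h J : ℚ) : ℝ) < 0 := by
  have hJ : partitionExponent J ≠ 0 := fun h0 => by
    have := weight_partitionExponent J
    rw [h0, weight, Finsupp.sum_zero_index] at this
    omega
  obtain ⟨ε, hε, hle⟩ := exists_pos_le_coeff_one_sub_ratioSeries
    (fun i => powers k (sinhRoot i)) (fun i => powers k (coshRoot i))
    (fun i j => pow_pos (sinhRoot_pos i) _)
    (fun i => powers_strictMono (sinhRoot_pos i).le (sinhRoot_lt_coshRoot i))
    (fun i => powers_strictMono
      ((sinhRoot_pos (i + 1)).trans (sinhRoot_lt_coshRoot (i + 1))).le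
      (coshRoot_succ_lt_sinhRoot i)) hJ
  have hs : ((-1 : ℝ) ^ Multiset.card J.parts) * (-1) ^ Multiset.card J.parts = 1 := by
    rw [← mul_pow]
    norm_num
  have hlim := (tendsto_coeff_ratioSeries J sinhRoot coshRoot tendsto_coeff_ratio).const_mul
    ((-1 : ℝ) ^ Multiset.card J.parts)
  simp only [← mul_assoc, hs, one_mul] at hlim
  refine (le_of_tendsto ((Filter.tendsto_add_atTop_iff_nat 2).2 hlim)
    (Filter.Eventually.of_forall fun M => ?_)).trans_lt (neg_lt_zero.2 hε)
  have hM := hle M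
  rw [weight_partitionExponent, map_sub, MvPolynomial.coeff_sub, PowerSeries.coeff_one,
    if_neg (by omega), MvPolynomial.coeff_zero, zero_sub] at hM
  linarith

end HirzebruchL

end

theorem corollary3 (k : ℕ) (hk : 1 ≤ k) (J : k.Partition) :
    HirzebruchL.h J ≠ 0 ∧
      (Even (Multiset.card J.parts) → HirzebruchL.h J < 0) ∧
      (Odd (Multiset.card J.parts) → 0 < HirzebruchL.h J) := by
  have hneg := HirzebruchL.neg_one_pow_mul_h_neg hk J
  refine ⟨fun h0 => ?_, fun he => ?_, fun ho => ?_⟩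
  · rw [h0, Rat.cast_zero, mul_zero] at hneg
    exact lt_irrefl _ hneg
  · rw [he.neg_one_pow, one_mul] at hneg
    exact_mod_cast hneg
  · rw [ho.neg_one_pow, neg_one_mul, neg_lt_zero] at hneg
    exact_mod_cast hneg
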